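/- Let $E=(E^0,E^1,r,s)$ be an arbitrary directed graph (no restriction on the number of vertices, or on the number of edges emitted by a vertex) and let $K$ be a field. The Leavitt path algebra $L_K(E)$ is the (not necessarily unital) associative $K$-algebra generated by a set $\{v : v\in E^0\}$ of pairwise orthogonal idempotents together with elements $\{e,e^*: e\in E^1\}$ subject to the relations: (1) $s(e)e=e=e\,r(e)$ for all $e\in E^1$; (2) $r(e)e^*=e^*=e^*s(e)$ for all $e\in E^1$; (3) $e^*e=r(e)$ for all $e\in E^1$, and $e^*f=0$ for all $e\neq f$ in $E^1$; (4) $v=\sum_{e\in E^1,\,s(e)=v}ee^*$ for every vertex $v$ which emits a non-empty finite set of edges. Left $L_K(E)$-modules are understood to be unitary, i.e. $L_K(E)M=M$; a simple module is a nonzero one whose only submodules are $0$ and itself, and injectivity is meant in the category of unitary left modules. If every simple left $L_K(E)$-module is injective (that is, if $L_K(E)$ is a left V-ring), then $L_K(E)$ is von Neumann regular: for every $a\in L_K(E)$ there is $b\in L_K(E)$ with $a=aba$. -/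

import Mathlib

universe u v w

/-! ### Leavitt path algebras

A directed graph `E = (E⁰, E¹, r, s)` is a quiver: `E⁰` is the type `V` of vertices, `E¹` is the type
`Quiver.Total V` of all arrows, `s e` is `e.left` and `r e` is `e.right`. No restriction is put on the
number of vertices or of arrows. -/

/-- The generators of the Leavitt path algebra: vertices `v`, edges `e` and ghost edges `e*`. -/
inductive LeavittGen (V : Type*) [Quiver V] where
  | vertex (v : V) : LeavittGen V
  | edge (e : Quiver.Total V) : LeavittGen V
  | ghost (e : Quiver.Total V) : LeavittGen V

/-- In a not necessarily unital ring `B`, the elements `P v`, `S e`, `T e` satisfy the defining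
relations that `v`, `e`, `e*` have in a Leavitt path algebra. -/
structure IsLeavittFamily (V : Type*) [Quiver V] {B : Type*} [NonUnitalRing B]
    (P : V → B) (S T : Quiver.Total V → B) : Prop where
  idem : ∀ v, P v * P v = P v
  orth : ∀ v w, v ≠ w → P v * P w = 0
  source_edge : ∀ e, P e.left * S e = S e
  edge_range : ∀ e, S e * P e.right = S e
  range_ghost : ∀ e, P e.right * T e = T e
  ghost_source : ∀ e, T e * P e.left = T e
  ck1_self : ∀ e, T e * S e = P e.right
  ck1_ne : ∀ e f, e ≠ f → T e * S f = 0
  ck2 : ∀ (v : V) (h : {e : Quiver.Total V | e.left = v}.Finite),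
    {e : Quiver.Total V | e.left = v}.Nonempty → P v = ∑ e ∈ h.toFinset, S e * T e

section Leavitt

variable (V : Type*) [Quiver V] (K : Type*) [Field K]

open LeavittGen FreeAlgebra in
/-- The defining relations of the Leavitt path algebra, in the free unital `K`-algebra on
the generators. The last one is imposed at the regular vertices, those which emit a non-empty finite
set of edges. -/
inductive LeavittRel : FreeAlgebra K (LeavittGen V) → FreeAlgebra K (LeavittGen V) → Prop
  | idem (v : V) : LeavittRel (ι K (vertex v) * ι K (vertex v)) (ι K (vertex v))
  | orth (v w : V) (h : v ≠ w) : LeavittRel (ι K (vertex v) * ι K (vertex w)) 0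
  | source_edge (e : Quiver.Total V) :
      LeavittRel (ι K (vertex e.left) * ι K (edge e)) (ι K (edge e))
  | edge_range (e : Quiver.Total V) :
      LeavittRel (ι K (edge e) * ι K (vertex e.right)) (ι K (edge e))
  | range_ghost (e : Quiver.Total V) :
      LeavittRel (ι K (vertex e.right) * ι K (ghost e)) (ι K (ghost e))
  | ghost_source (e : Quiver.Total V) :
      LeavittRel (ι K (ghost e) * ι K (vertex e.left)) (ι K (ghost e))
  | ck1_self (e : Quiver.Total V) :
      LeavittRel (ι K (ghost e) * ι K (edge e)) (ι K (vertex e.right))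
  | ck1_ne (e f : Quiver.Total V) (h : e ≠ f) : LeavittRel (ι K (ghost e) * ι K (edge f)) 0
  | ck2 (v : V) (h : {e : Quiver.Total V | e.left = v}.Finite)
      (hne : {e : Quiver.Total V | e.left = v}.Nonempty) :
      LeavittRel (ι K (vertex v)) (∑ e ∈ h.toFinset, ι K (edge e) * ι K (ghost e))

/-- The *unital* `K`-algebra presented by the generators and relations of the Leavitt path algebra.
It is the Leavitt path algebra with a new identity element adjoined. -/
abbrev LeavittUnital := RingQuot (LeavittRel V K)

/-- The image of a generator. -/
def leavittGen (x : LeavittGen V) : LeavittUnital V K :=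
  RingQuot.mkAlgHom K (LeavittRel V K) (FreeAlgebra.ι K x)

/-- The Leavitt path algebra `L_K(E)`, as a not necessarily unital `K`-algebra: the elements that are
linear combinations of non-empty words in the generators. It is the universal
non-unital `K`-algebra on the defining relations, see `LeavittPathAlgebra.existsUnique_hom`. -/
abbrev LeavittPathAlgebra :=
  ↥(NonUnitalAlgebra.adjoin K (Set.range (leavittGen V K)))

namespace LeavittPathAlgebra

/-- The generators, as elements of the Leavitt path algebra. -/
def gen (x : LeavittGen V) : LeavittPathAlgebra V K :=
  ⟨leavittGen V K x, NonUnitalAlgebra.subset_adjoin K ⟨x, rfl⟩⟩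

theorem isLeavittFamily_gen : IsLeavittFamily V (fun v => gen V K (.vertex v))
    (fun e => gen V K (.edge e)) (fun e => gen V K (.ghost e)) := by
  have key : ∀ {x y}, LeavittRel V K x y →
      RingQuot.mkAlgHom K (LeavittRel V K) x = RingQuot.mkAlgHom K (LeavittRel V K) y :=
    fun h => RingQuot.mkAlgHom_rel K h
  constructor
  · intro v; apply Subtype.ext; simpa [gen, leavittGen] using key (.idem v)
  · intro v w h; apply Subtype.ext; simpa [gen, leavittGen] using key (.orth v w h)
  · intro e; apply Subtype.ext; simpa [gen, leavittGen] using key (.source_edge e)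
  · intro e; apply Subtype.ext; simpa [gen, leavittGen] using key (.edge_range e)
  · intro e; apply Subtype.ext; simpa [gen, leavittGen] using key (.range_ghost e)
  · intro e; apply Subtype.ext; simpa [gen, leavittGen] using key (.ghost_source e)
  · intro e; apply Subtype.ext; simpa [gen, leavittGen] using key (.ck1_self e)
  · intro e f h; apply Subtype.ext; simpa [gen, leavittGen] using key (.ck1_ne e f h)
  · intro v h hne; apply Subtype.ext; simpa [gen, leavittGen] using key (.ck2 v h hne)

/-- The universal property of the Leavitt path algebra among not necessarily unital `K`-algebras. -/
theorem existsUnique_hom {B : Type*} [NonUnitalRing B] [Module K B] [IsScalarTower K B B]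
    [SMulCommClass K B B] (P : V → B) (S T : Quiver.Total V → B) (h : IsLeavittFamily V P S T) :
    ∃! φ : LeavittPathAlgebra V K →ₙₐ[K] B, (∀ v, φ (gen V K (.vertex v)) = P v) ∧
      (∀ e, φ (gen V K (.edge e)) = S e) ∧ ∀ e, φ (gen V K (.ghost e)) = T e := by
  let g : LeavittGen V → B := fun x => match x with
    | .vertex v => P v
    | .edge e => S e
    | .ghost e => T e
  let F : FreeAlgebra K (LeavittGen V) →ₐ[K] Unitization K B :=
    FreeAlgebra.lift K fun x => (Unitization.inr (g x) : Unitization K B)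
  have hF : ∀ ⦃x y⦄, LeavittRel V K x y → F x = F y := by
    intro x y hxy
    have hm (a b : B) : (Unitization.inr a * Unitization.inr b : Unitization K B)
      = Unitization.inr (a * b) := (Unitization.inr_mul K a b).symm
    induction hxy with
    | idem v => simp [F, g, hm, h.idem]
    | orth v w hne => simp [F, g, hm, h.orth v w hne]
    | source_edge e => simp [F, g, hm, h.source_edge]
    | edge_range e => simp [F, g, hm, h.edge_range]
    | range_ghost e => simp [F, g, hm, h.range_ghost]
    | ghost_source e => simp [F, g, hm, h.ghost_source]
    | ck1_self e => simp [F, g, hm, h.ck1_self]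
    | ck1_ne e f hne => simp [F, g, hm, h.ck1_ne e f hne]
    | ck2 v hf hne =>
      simp only [F, map_sum, map_mul, FreeAlgebra.lift_ι_apply, hm, g]
      rw [h.ck2 v hf hne]
      exact map_sum (Unitization.inrNonUnitalAlgHom K B) _ _
  let G : LeavittUnital V K →ₐ[K] Unitization K B := RingQuot.liftAlgHom K ⟨F, hF⟩
  have hG : ∀ x, G (leavittGen V K x) = Unitization.inr (g x) := by
    intro x; simp [G, F, leavittGen]
  have hr : ∀ x ∈ NonUnitalAlgebra.adjoin K (Set.range (leavittGen V K)),
      G x = Unitization.inr (G x).snd := by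
    have hle : NonUnitalAlgebra.adjoin K (Set.range (leavittGen V K)) ≤
        (NonUnitalAlgHom.range (Unitization.inrNonUnitalAlgHom K B)).comap
          (G : LeavittUnital V K →ₙₐ[K] Unitization K B) := by
      rw [NonUnitalAlgebra.adjoin_le_iff]
      rintro _ ⟨x, rfl⟩
      exact ⟨g x, (hG x).symm⟩
    intro x hx
    obtain ⟨b, hb⟩ := hle hx
    have hb' : (Unitization.inr b : Unitization K B) = G x := hb
    rw [← hb', Unitization.snd_inr]
  let φ : LeavittPathAlgebra V K →ₙₐ[K] B :=
    { toFun := fun x => (G x).snd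
      map_smul' := fun k x => by simp
      map_zero' := by simp
      map_add' := fun x y => by simp
      map_mul' := fun x y => by
        have hx := hr x x.2
        have hy := hr y y.2
        change (G (x.1 * y.1)).snd = _
        rw [map_mul, hx, hy, ← Unitization.inr_mul]
        simp }
  have hφ : ∀ x, φ (gen V K x) = g x := by
    intro x
    change (G (leavittGen V K x)).snd = g x
    rw [hG, Unitization.snd_inr]
  refine ⟨φ, ⟨fun v => hφ _, fun e => hφ _, fun e => hφ _⟩, ?_⟩
  rintro ψ ⟨h1, h2, h3⟩
  have hψ : ∀ x, ψ (gen V K x) = g x := by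
    intro x
    cases x with
    | vertex v => exact h1 v
    | edge e => exact h2 e
    | ghost e => exact h3 e
  refine NonUnitalAlgHom.ext fun x => ?_
  obtain ⟨x, hx⟩ := x
  induction hx using NonUnitalAlgebra.adjoin_induction with
  | mem x hx =>
    obtain ⟨y, rfl⟩ := hx
    exact (hψ y).trans (hφ y).symm
  | add x y hx hy ihx ihy =>
    have := congrArg₂ (· + ·) ihx ihy
    simp only [← map_add] at this
    exact this
  | zero => exact (map_zero ψ).trans (map_zero φ).symm
  | mul x y hx hy ihx ihy =>
    have := congrArg₂ (· * ·) ihx ihy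
    simp only [← map_mul] at this
    exact this
  | smul k x hx ih =>
    have := congrArg (k • ·) ih
    simp only [← map_smul] at this
    exact this

end LeavittPathAlgebra

end Leavitt

/-! ### Left modules over rings that need not have an identity -/

/-- A left module over a ring `R` that need not have an identity. -/
class NonUnitalModule (R : Type*) (M : Type*) [NonUnitalRing R] [AddCommGroup M]
    extends SMul R M where
  smul_add : ∀ (r : R) (x y : M), r • (x + y) = r • x + r • y
  add_smul : ∀ (r s : R) (x : M), (r + s) • x = r • x + s • x
  mul_smul : ∀ (r s : R) (x : M), (r * s) • x = r • s • x

namespace NonUnitalModule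

/-- `M` is unitary: `R M = M`. Over a ring with identity this says that `1` acts as the
identity map; over a ring with local units the modules in use are the unitary ones. -/
def IsUnitary (R M : Type*) [NonUnitalRing R] [AddCommGroup M] [NonUnitalModule R M] : Prop :=
  AddSubgroup.closure {x : M | ∃ (r : R) (m : M), x = r • m} = ⊤

/-- `M` is simple: `R M ≠ 0`, and `0` and `M` are the only submodules. -/
def IsSimple (R M : Type*) [NonUnitalRing R] [AddCommGroup M] [NonUnitalModule R M] : Prop :=
  (∃ (r : R) (m : M), r • m ≠ 0) ∧
    ∀ N : AddSubgroup M, (∀ (r : R), ∀ x ∈ N, r • x ∈ N) → N = ⊥ ∨ N = ⊤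

/-- `Q` is an injective object of the category of unitary left `R`-modules: a homomorphism from
a submodule of a unitary module to `Q` extends to the whole module. -/
def IsInjective (R : Type*) (Q : Type u) [NonUnitalRing R] [AddCommGroup Q]
    [NonUnitalModule R Q] : Prop :=
  IsUnitary R Q ∧
    ∀ (X Y : Type u) [AddCommGroup X] [NonUnitalModule R X] [AddCommGroup Y] [NonUnitalModule R Y],
      IsUnitary R X → IsUnitary R Y →
      ∀ (f : X →+ Y) (g : X →+ Q), (∀ (r : R) x, f (r • x) = r • f x) → Function.Injective f →
        (∀ (r : R) x, g (r • x) = r • g x) →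
        ∃ h : Y →+ Q, (∀ (r : R) y, h (r • y) = r • h y) ∧ ∀ x, h (f x) = g x

end NonUnitalModule

/-- A ring `R`, with or without identity, is von Neumann regular if every `a` in `R` is of the form
`a * b * a` with `b` in `R`. -/
def IsVonNeumannRegular (R : Type*) [NonUnitalRing R] : Prop :=
  ∀ a : R, ∃ b : R, a = a * b * a

/-!
A Leavitt path algebra that is a left V-ring is von Neumann regular. The bridge is acyclicity of the
graph, in the form: no infinite path is periodic.

*A periodic infinite path `q` gives a simple module that is not injective.* The Chen module of `q` has
as basis the infinite paths tail equivalent to `q`; an edge acts by prepending itself and a ghost edge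
by removing its edge. It is simple (`ChenPath.isSimple`): removing enough initial edges isolates one
path in the support of a given element, and any two basis paths are linked by removing and adding
edges. Now extend scalars to the dual numbers `K[ε]` and change the action by the factor `1 + ε`
whenever the path `q` is produced (and by its inverse whenever an edge is removed from `q`). The
multiples of `ε` form a copy of the Chen module. If that is injective, there is a homomorphism `h` from
the weighted module to the Chen module with `h (ε x) = x`. Let `c` be the product of the ghost edges
along the minimal period of `q`. Then `c q = (1 - ε) q` in the weighted module, so `m = h q` satisfies
`c m = m - q`; but `c` preserves the coefficient at `q` of every element of the Chen module
(`ChenPath.iterGhostOp_one_apply_self`), a contradiction (`ChenPath.not_isInjective`).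

*Without periodic infinite paths the algebra is regular.* Fix a finite set `F` of edges and let `w'` be
`w` minus the sum of the `e e*` over the edges `e` in `F` that leave `w`. For paths `α`, `β` in `F`
ending at the same `w` the elements `α w' β*` multiply like matrix units, although some of them may
vanish, so they span a subalgebra, and its elements inherit regularity from square matrices over `K`
(`exists_eq_mul_mul_of_mem_span_matrixUnits`). By acyclicity and finiteness of `F`, repeated use of
`w = w' + ∑ e e*` terminates and expresses all vertices, and hence the edges and ghosts from `F`, by
matrix units (`IsLeavittFamily.vertex_mem_span`). Every element of the algebra involves only finitely
many edges.
-/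

/-! ### Combinations of matrix units over a field -/

theorem Matrix.exists_mul_mul_self {K n : Type*} [Field K] [Fintype n] [DecidableEq n]
    (A : Matrix n n K) : ∃ B : Matrix n n K, A * B * A = A := by
  let f := Matrix.toLin' A
  obtain ⟨g, hg⟩ := f.rangeRestrict.exists_rightInverse_of_surjective f.range_rangeRestrict
  obtain ⟨g', hg'⟩ := g.exists_extend
  refine ⟨LinearMap.toMatrix' g', Matrix.toLin'.injective ?_⟩
  rw [Matrix.toLin'_mul, Matrix.toLin'_mul, Matrix.toLin'_toMatrix']
  refine LinearMap.ext fun z => ?_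
  have h1 : g' (f z) = g (f.rangeRestrict z) := LinearMap.congr_fun hg' (f.rangeRestrict z)
  have h2 := congrArg Subtype.val (LinearMap.congr_fun hg (f.rangeRestrict z))
  change f (g' (f z)) = f z
  rw [h1]
  exact h2

section MatrixUnits

variable {K R ι W : Type*} [Field K] [NonUnitalRing R] [Module K R] [IsScalarTower K R R]
  [SMulCommClass K R R] {x y : ι → R} {t : ι → W} {Q : W → R}

/-- Combinations of the matrix units `x i * y j` multiply like their coefficient matrices, provided
that in each nonzero product of entries one factor lies in a diagonal block for `t`. The matrix units
may be zero or linearly dependent. -/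
theorem sum_smul_mul_sum_smul [Fintype ι] [DecidableEq ι]
    (hyx : ∀ i j, y j * x i = if i = j then Q (t i) else 0)
    (hx : ∀ i, x i * Q (t i) = x i) (hy : ∀ i, Q (t i) * y i = y i) (A B : Matrix ι ι K)
    (hAB : ∀ i j l, A i j * B j l ≠ 0 → t i = t j ∨ t j = t l) :
    (∑ i, ∑ j, A i j • (x i * y j)) * (∑ i, ∑ j, B i j • (x i * y j)) =
      ∑ i, ∑ j, (A * B) i j • (x i * y j) := by
  simp only [Finset.sum_mul]
  simp only [Finset.mul_sum, Matrix.mul_apply, Finset.sum_smul]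
  refine Finset.sum_congr rfl fun i _ => ?_
  have key : ∀ j k l, A i j • (x i * y j) * B k l • (x k * y l) =
      if k = j then (A i j * B j l) • (x i * y l) else 0 := by
    intro j k l
    have e : x i * y j * (x k * y l) = x i * (y j * x k) * y l := by simp only [mul_assoc]
    rw [smul_mul_smul_comm, e, hyx]
    split_ifs with hkj
    · subst hkj
      by_cases h0 : A i k * B k l = 0
      · rw [h0, zero_smul, zero_smul]
      · rcases hAB i k l h0 with h | h
        · rw [← h, hx]
        · rw [h, mul_assoc, hy]
    · rw [mul_zero, zero_mul, smul_zero]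
  rw [Finset.sum_comm (f := fun l j => (A i j * B j l) • (x i * y l))]
  refine Finset.sum_congr rfl fun j _ => ?_
  rw [Finset.sum_comm]
  refine Finset.sum_congr rfl fun l _ => ?_
  rw [Finset.sum_congr rfl fun k _ => key j k l, Finset.sum_ite_eq' Finset.univ j,
    if_pos (Finset.mem_univ j)]

/-- A combination of matrix units `x i * y j` with `t i = t j` is von Neumann regular: a generalized
inverse of its coefficient matrix gives the required element. -/
theorem exists_eq_mul_mul_of_mem_span_matrixUnits
    (hyx : ∀ i, y i * x i = Q (t i)) (hyx' : ∀ i j, i ≠ j → y j * x i = 0)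
    (hx : ∀ i, x i * Q (t i) = x i) (hy : ∀ i, Q (t i) * y i = y i) {a : R}
    (ha : a ∈ Submodule.span K ((fun p : ι × ι => x p.1 * y p.2) '' {p | t p.1 = t p.2})) :
    ∃ b, a = a * b * a := by
  classical
  obtain ⟨c, hc, rfl⟩ := (Finsupp.mem_span_image_iff_linearCombination K).1 ha
  let J : Finset ι := c.support.image Prod.fst ∪ c.support.image Prod.snd
  let A : Matrix J J K := fun i j => c (i, j)
  have hA : ∀ i j, A i j ≠ 0 → t i = t j := fun i j h =>
    hc (Finsupp.mem_support_iff.2 h)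
  have hsum : Finsupp.linearCombination K (fun p : ι × ι => x p.1 * y p.2) c =
      ∑ i, ∑ j, A i j • (x i * y j) := by
    rw [Finsupp.linearCombination_apply, Finsupp.sum_of_support_subset (s := J ×ˢ J)]
    · rw [Finset.sum_product, ← Finset.sum_coe_sort J]
      refine Finset.sum_congr rfl fun i _ => ?_
      rw [← Finset.sum_coe_sort J]
    · intro p hp
      exact Finset.mem_product.2 ⟨Finset.mem_union_left _ (Finset.mem_image_of_mem _ hp),
        Finset.mem_union_right _ (Finset.mem_image_of_mem _ hp)⟩
    · simp
  obtain ⟨B, hB⟩ := A.exists_mul_mul_self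
  have hyx'' : ∀ i j : J, y j * x i = if i = j then Q (t i) else 0 := by
    intro i j
    split_ifs with h
    · rw [← h, hyx]
    · exact hyx' _ _ fun h' => h (Subtype.ext h')
  refine ⟨∑ i, ∑ j, B i j • (x i * y j), ?_⟩
  have hm := sum_smul_mul_sum_smul (K := K) (x := fun i : J => x i) (y := fun i : J => y i)
    (t := fun i : J => t i) hyx'' (fun i => hx i) (fun i => hy i)
  rw [hsum, hm A B fun i j l h => .inl (hA i j (left_ne_zero_of_mul h)),
    hm (A * B) A fun i j l h => .inr (hA j l (right_ne_zero_of_mul h)), hB]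

end MatrixUnits

/-! ### Regularity over a graph without periodic infinite paths -/

/-- `p` is an infinite path: each edge starts where the previous one ends. -/
def IsInfinitePath {V : Type*} [Quiver V] (p : ℕ → Quiver.Total V) : Prop :=
  ∀ i, (p i).right = (p (i + 1)).left

/-- An infinite chain of composable edges from a finite set repeats an edge, and the stretch between
the two occurrences unrolls to a periodic infinite path. -/
theorem wellFounded_follows_of_finite {V : Type*} [Quiver V]
    (hE : ∀ q : ℕ → Quiver.Total V, IsInfinitePath q → ∀ n, 0 < n → ¬ ∀ i, q (i + n) = q i)
    (F : Finset (Quiver.Total V)) :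
    WellFounded fun e f : F => f.1.right = e.1.left := by
  rw [wellFounded_iff_isEmpty_descending_chain]
  refine ⟨fun ⟨s, hs⟩ => ?_⟩
  obtain ⟨a, b, hab, hsab⟩ : ∃ a b, a < b ∧ s a = s b := by
    obtain ⟨a, b, hne, h⟩ := Finite.exists_ne_map_eq_of_infinite s
    rcases lt_or_gt_of_ne hne with h' | h'
    · exact ⟨a, b, h', h⟩
    · exact ⟨b, a, h', h.symm⟩
  have hm : 0 < b - a := by omega
  refine hE (fun i => (s (a + i % (b - a))).1) (fun i => ?_) (b - a) hm fun i => by simp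
  have hlt := Nat.mod_lt i hm
  rcases Nat.lt_or_ge (i % (b - a) + 1) (b - a) with h | h
  · have : (i + 1) % (b - a) = i % (b - a) + 1 := by
      rw [Nat.add_mod, ← Nat.mod_eq_of_lt h, Nat.add_mod (i % (b - a)) 1]; simp
    simp only [this]
    exact hs _
  · have h1 : i % (b - a) + 1 = b - a := by omega
    have h2 : (i + 1) % (b - a) = 0 := by
      rw [← Nat.mod_add_mod, h1, Nat.mod_self]
    simp only [h2]
    have h3 : a + i % (b - a) + 1 = b := by omega
    have := hs (a + i % (b - a))
    rw [h3, ← hsab] at this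
    exact this

section Acyclic

variable {V : Type*} [Quiver V]

/-- The source of the path with list of edges `l` and last vertex `w`. -/
def pathSource : List (Quiver.Total V) → V → V
  | [], w => w
  | e :: _, _ => e.left

/-- `l` is the list of edges of a path that uses only edges from `F` and ends at `w`. -/
def IsPathTo (F : Finset (Quiver.Total V)) : List (Quiver.Total V) → V → Prop
  | [], _ => True
  | e :: l, w => e ∈ F ∧ e.right = pathSource l w ∧ IsPathTo F l w

variable {R : Type*} [NonUnitalRing R] (P : V → R) (S T : Quiver.Total V → R)
  (F : Finset (Quiver.Total V))

open scoped Classical in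
/-- The part of the idempotent `P w` left over by the range projections of the edges from `F`. -/
noncomputable def vertexDefect (w : V) : R := P w - ∑ e ∈ F with e.left = w, S e * T e

/-- The product of the edges in `l` and the defect at `w`. -/
noncomputable def pathDefect : List (Quiver.Total V) → V → R
  | [], w => vertexDefect P S T F w
  | e :: l, w => S e * pathDefect l w

/-- The product of the defect at `w` and the ghosts of the edges in `l`, in reverse order. -/
noncomputable def ghostDefect : List (Quiver.Total V) → V → R
  | [], w => vertexDefect P S T F w
  | e :: l, w => ghostDefect l w * T e

variable {P S T F} (h : IsLeavittFamily V P S T)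

namespace IsLeavittFamily
include h

theorem vertex_mul_edge_of_ne {w : V} {e : Quiver.Total V} (hw : e.left ≠ w) : P w * S e = 0 := by
  rw [← h.source_edge, ← mul_assoc, h.orth _ _ hw.symm, zero_mul]

theorem ghost_mul_vertex_of_ne {w : V} {e : Quiver.Total V} (hw : e.left ≠ w) : T e * P w = 0 := by
  rw [← h.ghost_source, mul_assoc, h.orth _ _ hw, mul_zero]

theorem vertexDefect_mul_edge {e : Quiver.Total V} (he : e ∈ F) (w : V) :
    vertexDefect P S T F w * S e = 0 := by
  classical
  rw [vertexDefect, sub_mul, Finset.sum_mul]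
  by_cases hw : e.left = w
  · rw [Finset.sum_eq_single e]
    · rw [mul_assoc, h.ck1_self, h.edge_range, ← hw, h.source_edge, sub_self]
    · intro f _ hf
      rw [mul_assoc, h.ck1_ne _ _ hf, mul_zero]
    · intro h'
      exact absurd (Finset.mem_filter.2 ⟨he, hw⟩) h'
  · rw [h.vertex_mul_edge_of_ne hw, Finset.sum_eq_zero, sub_zero]
    intro f hf
    rw [mul_assoc, h.ck1_ne, mul_zero]
    rintro rfl
    exact hw (Finset.mem_filter.1 hf).2

theorem ghost_mul_vertexDefect {e : Quiver.Total V} (he : e ∈ F) (w : V) :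
    T e * vertexDefect P S T F w = 0 := by
  classical
  rw [vertexDefect, mul_sub, Finset.mul_sum]
  by_cases hw : e.left = w
  · rw [Finset.sum_eq_single e]
    · rw [← mul_assoc, h.ck1_self, h.range_ghost, ← hw, h.ghost_source, sub_self]
    · intro f _ hf
      rw [← mul_assoc, h.ck1_ne _ _ hf.symm, zero_mul]
    · intro h'
      exact absurd (Finset.mem_filter.2 ⟨he, hw⟩) h'
  · rw [h.ghost_mul_vertex_of_ne hw, Finset.sum_eq_zero, sub_zero]
    intro f hf
    rw [← mul_assoc, h.ck1_ne, zero_mul]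
    rintro rfl
    exact hw (Finset.mem_filter.1 hf).2

theorem vertex_mul_vertexDefect (w : V) :
    P w * vertexDefect P S T F w = vertexDefect P S T F w := by
  classical
  rw [vertexDefect, mul_sub, h.idem, Finset.mul_sum]
  congr 1
  refine Finset.sum_congr rfl fun e he => ?_
  rw [← mul_assoc, ← (Finset.mem_filter.1 he).2, h.source_edge]

theorem vertexDefect_mul_vertex (w : V) :
    vertexDefect P S T F w * P w = vertexDefect P S T F w := by
  classical
  rw [vertexDefect, sub_mul, h.idem, Finset.sum_mul]
  congr 1
  refine Finset.sum_congr rfl fun e he => ?_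
  rw [mul_assoc, ← (Finset.mem_filter.1 he).2, h.ghost_source]

theorem vertexDefect_mul_self (w : V) :
    vertexDefect P S T F w * vertexDefect P S T F w = vertexDefect P S T F w := by
  classical
  conv_lhs => lhs; rw [vertexDefect]
  rw [sub_mul, h.vertex_mul_vertexDefect, Finset.sum_mul, Finset.sum_eq_zero, sub_zero]
  intro e he
  rw [mul_assoc, h.ghost_mul_vertexDefect (Finset.mem_filter.1 he).1, mul_zero]

theorem vertexDefect_mul_of_ne {w z : V} (hwz : w ≠ z) :
    vertexDefect P S T F w * vertexDefect P S T F z = 0 := by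
  rw [← h.vertexDefect_mul_vertex w, ← h.vertex_mul_vertexDefect z, mul_assoc, ← mul_assoc (P w),
    h.orth _ _ hwz, zero_mul, mul_zero]

theorem pathDefect_mul_vertexDefect (l : List (Quiver.Total V)) (w : V) :
    pathDefect P S T F l w * vertexDefect P S T F w = pathDefect P S T F l w := by
  induction l with
  | nil => exact h.vertexDefect_mul_self w
  | cons e l ih => rw [pathDefect, mul_assoc, ih]

theorem vertexDefect_mul_ghostDefect (l : List (Quiver.Total V)) (w : V) :
    vertexDefect P S T F w * ghostDefect P S T F l w = ghostDefect P S T F l w := by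
  induction l with
  | nil => exact h.vertexDefect_mul_self w
  | cons e l ih => rw [ghostDefect, ← mul_assoc, ih]

theorem vertex_mul_pathDefect (l : List (Quiver.Total V)) (w : V) :
    P (pathSource l w) * pathDefect P S T F l w = pathDefect P S T F l w := by
  cases l with
  | nil => exact h.vertex_mul_vertexDefect w
  | cons e l => rw [pathDefect, pathSource, ← mul_assoc, h.source_edge]

theorem ghostDefect_mul_pathDefect_self {l : List (Quiver.Total V)} {w : V}
    (hl : IsPathTo F l w) :
    ghostDefect P S T F l w * pathDefect P S T F l w = vertexDefect P S T F w := by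
  induction l with
  | nil => exact h.vertexDefect_mul_self w
  | cons e l ih =>
    rw [ghostDefect, pathDefect, mul_assoc, ← mul_assoc (T e), h.ck1_self, hl.2.1,
      h.vertex_mul_pathDefect, ih hl.2.2]

theorem ghostDefect_mul_pathDefect_of_ne {l m : List (Quiver.Total V)} {w z : V}
    (hl : IsPathTo F l w) (hm : IsPathTo F m z) (hne : (l, w) ≠ (m, z)) :
    ghostDefect P S T F l w * pathDefect P S T F m z = 0 := by
  induction l generalizing m with
  | nil =>
    cases m with
    | nil => exact h.vertexDefect_mul_of_ne fun hwz => hne (by rw [hwz])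
    | cons f m => rw [ghostDefect, pathDefect, ← mul_assoc, h.vertexDefect_mul_edge hm.1, zero_mul]
  | cons e l ih =>
    cases m with
    | nil => rw [ghostDefect, pathDefect, mul_assoc, h.ghost_mul_vertexDefect hl.1, mul_zero]
    | cons f m =>
      rw [ghostDefect, pathDefect, mul_assoc, ← mul_assoc (T e)]
      by_cases hef : e = f
      · subst hef
        rw [h.ck1_self, hm.2.1, h.vertex_mul_pathDefect, ih hl.2.2 hm.2.2]
        intro h'
        refine hne ?_
        simp only [Prod.mk.injEq] at h' ⊢
        simp [h'.1, h'.2]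
      · rw [h.ck1_ne _ _ hef, zero_mul, mul_zero]

end IsLeavittFamily

variable (P S T F) in
/-- The linear span of the matrix units given by pairs of paths in `F` with a common end. -/
def matrixUnitSpan (K : Type*) [Field K] [Module K R] : Submodule K R :=
  Submodule.span K {a | ∃ l m w, IsPathTo F l w ∧ IsPathTo F m w ∧
    a = pathDefect P S T F l w * ghostDefect P S T F m w}

variable {K : Type*} [Field K] [Module K R] [IsScalarTower K R R] [SMulCommClass K R R]

namespace IsLeavittFamily
include h

theorem mul_mem_matrixUnitSpan {a b : R} (ha : a ∈ matrixUnitSpan P S T F K)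
    (hb : b ∈ matrixUnitSpan P S T F K) : a * b ∈ matrixUnitSpan P S T F K := by
  induction ha, hb using Submodule.span_induction₂ with
  | mem_mem a b ha hb =>
    obtain ⟨l, m, w, hl, hm, rfl⟩ := ha
    obtain ⟨l', m', z, hl', hm', rfl⟩ := hb
    rw [mul_assoc, ← mul_assoc (ghostDefect P S T F m w)]
    by_cases he : (m, w) = (l', z)
    · obtain ⟨rfl, rfl⟩ := Prod.mk.inj he
      rw [h.ghostDefect_mul_pathDefect_self hm, h.vertexDefect_mul_ghostDefect]
      exact Submodule.subset_span ⟨l, m', w, hl, hm', rfl⟩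
    · rw [h.ghostDefect_mul_pathDefect_of_ne hm hl' he, zero_mul, mul_zero]
      exact zero_mem _
  | zero_left => rw [zero_mul]; exact zero_mem _
  | zero_right => rw [mul_zero]; exact zero_mem _
  | add_left a b c _ _ _ h1 h2 => rw [add_mul]; exact add_mem h1 h2
  | add_right a b c _ _ _ h1 h2 => rw [mul_add]; exact add_mem h1 h2
  | smul_left r a b _ _ h1 => rw [smul_mul_assoc]; exact Submodule.smul_mem _ _ h1
  | smul_right r a b _ _ h1 => rw [mul_smul_comm]; exact Submodule.smul_mem _ _ h1

theorem exists_eq_mul_mul_of_mem_matrixUnitSpan {a : R} (ha : a ∈ matrixUnitSpan P S T F K) :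
    ∃ b, a = a * b * a := by
  refine exists_eq_mul_mul_of_mem_span_matrixUnits (K := K)
    (ι := {p : List (Quiver.Total V) × V // IsPathTo F p.1 p.2})
    (x := fun p => pathDefect P S T F p.1.1 p.1.2) (y := fun p => ghostDefect P S T F p.1.1 p.1.2)
    (t := fun p => p.1.2) (Q := vertexDefect P S T F)
    (fun i => h.ghostDefect_mul_pathDefect_self i.2)
    (fun i j hij => h.ghostDefect_mul_pathDefect_of_ne j.2 i.2
      fun h' => hij (Subtype.ext h'.symm))
    (fun i => h.pathDefect_mul_vertexDefect _ _) (fun i => h.vertexDefect_mul_ghostDefect _ _) ?_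
  refine Submodule.span_mono ?_ ha
  rintro _ ⟨l, m, w, hl, hm, rfl⟩
  exact ⟨(⟨(l, w), hl⟩, ⟨(m, w), hm⟩), rfl, rfl⟩

/-- Given the decompositions of the idempotents at the ends of the edges from `F` that leave `v`,
the idempotent at `v` is a sum of diagonal matrix units. -/
theorem vertex_mem_span_of_forall {v : V}
    (hv : ∀ e ∈ F, e.left = v → P e.right ∈ Submodule.span K {a | ∃ l w, IsPathTo F l w ∧
      pathSource l w = e.right ∧ a = pathDefect P S T F l w * ghostDefect P S T F l w}) :
    P v ∈ Submodule.span K {a | ∃ l w, IsPathTo F l w ∧ pathSource l w = v ∧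
      a = pathDefect P S T F l w * ghostDefect P S T F l w} := by
  classical
  have hP : P v = vertexDefect P S T F v + ∑ e ∈ F with e.left = v, S e * T e := by
    rw [vertexDefect, sub_add_cancel]
  rw [hP]
  refine add_mem (Submodule.subset_span ⟨[], v, trivial, rfl, ?_⟩) (Submodule.sum_mem _ ?_)
  · exact (h.vertexDefect_mul_self v).symm
  intro e he
  obtain ⟨heF, hev⟩ := Finset.mem_filter.1 he
  have hr : S e * T e = S e * P e.right * T e := by rw [h.edge_range]
  rw [hr]
  refine Submodule.span_induction (p := fun a _ => S e * a * T e ∈ _) ?_ ?_ ?_ ?_ (hv e heF hev)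
  · rintro _ ⟨l, w, hl, hs, rfl⟩
    refine Submodule.subset_span ⟨e :: l, w, ⟨heF, hs.symm, hl⟩, hev, ?_⟩
    simp only [pathDefect, ghostDefect, mul_assoc]
  · simp
  · intro a b _ _ ha hb
    rw [mul_add, add_mul]
    exact add_mem ha hb
  · intro k a _ ha
    rw [mul_smul_comm, smul_mul_assoc]
    exact Submodule.smul_mem _ _ ha

theorem vertex_mem_span
    (hF : WellFounded fun e f : F => f.1.right = e.1.left) (v : V) :
    P v ∈ Submodule.span K {a | ∃ l w, IsPathTo F l w ∧ pathSource l w = v ∧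
      a = pathDefect P S T F l w * ghostDefect P S T F l w} := by
  refine h.vertex_mem_span_of_forall fun e he _ => ?_
  suffices H : ∀ f : F, P f.1.right ∈ Submodule.span K {a | ∃ l w, IsPathTo F l w ∧
      pathSource l w = f.1.right ∧ a = pathDefect P S T F l w * ghostDefect P S T F l w} from
    H ⟨e, he⟩
  intro f
  induction f using hF.induction with
  | _ f ih => exact h.vertex_mem_span_of_forall fun e he hl => ih ⟨e, he⟩ hl.symm

theorem vertex_mem_matrixUnitSpan
    (hF : WellFounded fun e f : F => f.1.right = e.1.left) (v : V) :
    P v ∈ matrixUnitSpan P S T F K := by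
  refine Submodule.span_mono ?_ (h.vertex_mem_span (K := K) hF v)
  rintro _ ⟨l, w, hl, _, rfl⟩
  exact ⟨l, l, w, hl, hl, rfl⟩

theorem edge_mem_matrixUnitSpan
    (hF : WellFounded fun e f : F => f.1.right = e.1.left) {e : Quiver.Total V} (he : e ∈ F) :
    S e ∈ matrixUnitSpan P S T F K := by
  rw [← h.edge_range]
  refine Submodule.span_induction (p := fun a _ => S e * a ∈ _) ?_ ?_ ?_ ?_
    (h.vertex_mem_span (K := K) hF e.right)
  · rintro _ ⟨l, w, hl, hs, rfl⟩
    exact Submodule.subset_span ⟨e :: l, l, w, ⟨he, hs.symm, hl⟩, hl, (mul_assoc _ _ _).symm⟩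
  · simp
  · intro a b _ _ ha hb
    rw [mul_add]
    exact add_mem ha hb
  · intro k a _ ha
    rw [mul_smul_comm]
    exact Submodule.smul_mem _ _ ha

theorem ghost_mem_matrixUnitSpan
    (hF : WellFounded fun e f : F => f.1.right = e.1.left) {e : Quiver.Total V} (he : e ∈ F) :
    T e ∈ matrixUnitSpan P S T F K := by
  rw [← h.range_ghost]
  refine Submodule.span_induction (p := fun a _ => a * T e ∈ _) ?_ ?_ ?_ ?_
    (h.vertex_mem_span (K := K) hF e.right)
  · rintro _ ⟨l, w, hl, hs, rfl⟩
    exact Submodule.subset_span ⟨l, e :: l, w, hl, ⟨he, hs.symm, hl⟩, mul_assoc _ _ _⟩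
  · simp
  · intro a b _ _ ha hb
    rw [add_mul]
    exact add_mem ha hb
  · intro k a _ ha
    rw [smul_mul_assoc]
    exact Submodule.smul_mem _ _ ha

end IsLeavittFamily

end Acyclic

theorem LeavittPathAlgebra.induction {V : Type*} [Quiver V] {K : Type*} [Field K]
    {p : LeavittPathAlgebra V K → Prop} (gen : ∀ x, p (gen V K x)) (zero : p 0)
    (add : ∀ x y, p x → p y → p (x + y)) (mul : ∀ x y, p x → p y → p (x * y))
    (smul : ∀ (k : K) x, p x → p (k • x)) (x : LeavittPathAlgebra V K) : p x := by
  obtain ⟨x, hx⟩ := x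
  induction hx using NonUnitalAlgebra.adjoin_induction with
  | mem x hx =>
    obtain ⟨y, rfl⟩ := hx
    exact gen y
  | add x y hx hy ihx ihy => exact add ⟨x, hx⟩ ⟨y, hy⟩ ihx ihy
  | zero => exact zero
  | mul x y hx hy ihx ihy => exact mul ⟨x, hx⟩ ⟨y, hy⟩ ihx ihy
  | smul k x hx ih => exact smul k ⟨x, hx⟩ ih

/-- Each element of the algebra lies in the span of the matrix units for all sufficiently large finite
sets of edges. -/
theorem LeavittPathAlgebra.isVonNeumannRegular_of_forall_not_periodic {V : Type*} [Quiver V]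
    {K : Type*} [Field K]
    (hE : ∀ q : ℕ → Quiver.Total V, IsInfinitePath q → ∀ n, 0 < n → ¬ ∀ i, q (i + n) = q i) :
    IsVonNeumannRegular (LeavittPathAlgebra V K) := by
  classical
  intro a
  have h := isLeavittFamily_gen V K
  obtain ⟨F, hF⟩ : ∃ F : Finset (Quiver.Total V), ∀ F', F ⊆ F' →
      a ∈ matrixUnitSpan (fun v => gen V K (.vertex v)) (fun e => gen V K (.edge e))
        (fun e => gen V K (.ghost e)) F' K := by
    induction a using LeavittPathAlgebra.induction with
    | gen x =>
      cases x with
      | vertex v =>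
        exact ⟨∅, fun F' _ => h.vertex_mem_matrixUnitSpan (wellFounded_follows_of_finite hE F') v⟩
      | edge e =>
        exact ⟨{e}, fun F' hF' => h.edge_mem_matrixUnitSpan (wellFounded_follows_of_finite hE F')
          (hF' (Finset.mem_singleton_self e))⟩
      | ghost e =>
        exact ⟨{e}, fun F' hF' => h.ghost_mem_matrixUnitSpan (wellFounded_follows_of_finite hE F')
          (hF' (Finset.mem_singleton_self e))⟩
    | zero => exact ⟨∅, fun _ _ => zero_mem _⟩
    | add x y hx hy =>
      obtain ⟨F, hF⟩ := hx
      obtain ⟨G, hG⟩ := hy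
      exact ⟨F ∪ G, fun F' hF' => add_mem (hF _ (Finset.union_subset_left hF'))
        (hG _ (Finset.union_subset_right hF'))⟩
    | mul x y hx hy =>
      obtain ⟨F, hF⟩ := hx
      obtain ⟨G, hG⟩ := hy
      exact ⟨F ∪ G, fun F' hF' => h.mul_mem_matrixUnitSpan (hF _ (Finset.union_subset_left hF'))
        (hG _ (Finset.union_subset_right hF'))⟩
    | smul k x hx =>
      obtain ⟨F, hF⟩ := hx
      exact ⟨F, fun F' hF' => Submodule.smul_mem _ k (hF F' hF')⟩
  exact h.exists_eq_mul_mul_of_mem_matrixUnitSpan (hF F subset_rfl)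

/-! ### Weighted actions on tail equivalent infinite paths -/

section Chen

variable {V : Type*} [Quiver V]

/-- The infinite paths that agree with `q` after a finite number of edges is removed from each. -/
abbrev ChenPath (q : ℕ → Quiver.Total V) :=
  {p : ℕ → Quiver.Total V // IsInfinitePath p ∧ ∃ j k, ∀ i, p (i + j) = q (i + k)}

namespace ChenPath

variable {q : ℕ → Quiver.Total V}

/-- The path without its first edge. -/
def tail (p : ChenPath q) : ChenPath q :=
  ⟨fun i => p.1 (i + 1), fun i => p.2.1 (i + 1), by
    obtain ⟨j, k, h⟩ := p.2.2
    refine ⟨j, k + 1, fun i => ?_⟩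
    rw [show i + (k + 1) = i + 1 + k by omega, ← h]
    exact congrArg p.1 (by omega)⟩

/-- The path with first edge `e`, followed by `p`. -/
def cons (e : Quiver.Total V) (p : ChenPath q) (h : e.right = (p.1 0).left) : ChenPath q :=
  ⟨fun i => i.casesOn e p.1, fun i => by
    cases i with
    | zero => exact h
    | succ i => exact p.2.1 i, by
    obtain ⟨j, k, h⟩ := p.2.2
    exact ⟨j + 1, k, h⟩⟩

@[simp] theorem cons_zero (e : Quiver.Total V) (p : ChenPath q) (h : e.right = (p.1 0).left) :
    (cons e p h).1 0 = e := rfl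

@[simp] theorem tail_cons (e : Quiver.Total V) (p : ChenPath q) (h : e.right = (p.1 0).left) :
    (cons e p h).tail = p := rfl

theorem right_head (p : ChenPath q) : (p.1 0).right = (p.tail.1 0).left := p.2.1 0

@[simp] theorem cons_tail (p : ChenPath q) : cons (p.1 0) p.tail p.right_head = p := by
  refine Subtype.ext (funext fun i => ?_)
  cases i <;> rfl

theorem iterate_tail_apply (p : ChenPath q) (n i : ℕ) : (tail^[n] p).1 i = p.1 (i + n) := by
  induction n generalizing p with
  | zero => rfl
  | succ n ih =>
    rw [Function.iterate_succ_apply, ih]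
    change p.1 (i + n + 1) = _
    rfl

theorem exists_iterate_tail_eq (p p' : ChenPath q) : ∃ m n, tail^[m] p = tail^[n] p' := by
  obtain ⟨j, k, h⟩ := p.2.2
  obtain ⟨j', k', h'⟩ := p'.2.2
  refine ⟨j + k', j' + k, Subtype.ext (funext fun i => ?_)⟩
  rw [iterate_tail_apply, iterate_tail_apply, show i + (j + k') = i + k' + j by omega, h,
    show i + (j' + k) = i + k + j' by omega, h']
  congr 1
  omega

theorem eq_of_forall_lt_of_iterate_tail_eq {x y : ChenPath q} {n : ℕ}
    (h : ∀ i < n, x.1 i = y.1 i) (ht : tail^[n] x = tail^[n] y) : x = y := by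
  refine Subtype.ext (funext fun i => ?_)
  rcases Nat.lt_or_ge i n with hi | hi
  · exact h i hi
  · obtain ⟨d, rfl⟩ := Nat.exists_eq_add_of_le' hi
    rw [← iterate_tail_apply, ht, iterate_tail_apply]

variable {A : Type*} [CommRing A] (θ : ChenPath q → Aˣ)

open scoped Classical in
/-- The action of a vertex on the free module over the paths. -/
noncomputable def vertexOp (A : Type*) [CommRing A] (v : V) : Module.End A (ChenPath q →₀ A) :=
  Finsupp.linearCombination A fun x => if (x.1 0).left = v then Finsupp.single x 1 else 0

open scoped Classical in
/-- The action of an edge `e` on the free module over the paths: `p` goes to `θ (e p) • e p`. -/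
noncomputable def edgeOp (e : Quiver.Total V) : Module.End A (ChenPath q →₀ A) :=
  Finsupp.linearCombination A fun x =>
    if h : e.right = (x.1 0).left then Finsupp.single (cons e x h) ↑(θ (cons e x h)) else 0

open scoped Classical in
/-- The action of a ghost edge on the free module over the paths: `e p` goes to `θ (e p)⁻¹ • p`,
and paths that do not start with `e` go to `0`. -/
noncomputable def ghostOp (e : Quiver.Total V) : Module.End A (ChenPath q →₀ A) :=
  Finsupp.linearCombination A fun x =>
    if x.1 0 = e then Finsupp.single x.tail ↑(θ x)⁻¹ else 0

theorem vertexOp_single {v : V} {x : ChenPath q} (h : (x.1 0).left = v) (a : A) :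
    vertexOp A v (Finsupp.single x a) = Finsupp.single x a := by
  simp [vertexOp, h]

theorem vertexOp_single_of_ne {v : V} {x : ChenPath q} (h : (x.1 0).left ≠ v) (a : A) :
    vertexOp A v (Finsupp.single x a) = 0 := by
  simp [vertexOp, h]

theorem edgeOp_single {e : Quiver.Total V} {x : ChenPath q} (h : e.right = (x.1 0).left) (a : A) :
    edgeOp θ e (Finsupp.single x a) = Finsupp.single (cons e x h) (a * θ (cons e x h)) := by
  simp [edgeOp, h]

theorem edgeOp_single_of_ne {e : Quiver.Total V} {x : ChenPath q} (h : e.right ≠ (x.1 0).left)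
    (a : A) : edgeOp θ e (Finsupp.single x a) = 0 := by
  simp [edgeOp, h]

theorem ghostOp_single {e : Quiver.Total V} {x : ChenPath q} (h : x.1 0 = e) (a : A) :
    ghostOp θ e (Finsupp.single x a) = Finsupp.single x.tail (a * ↑(θ x)⁻¹) := by
  simp [ghostOp, h]

theorem ghostOp_single_of_ne {e : Quiver.Total V} {x : ChenPath q} (h : x.1 0 ≠ e) (a : A) :
    ghostOp θ e (Finsupp.single x a) = 0 := by
  simp [ghostOp, h]

theorem isLeavittFamily_op : IsLeavittFamily V (vertexOp (q := q) A) (edgeOp θ) (ghostOp θ) where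
  idem v := Finsupp.lhom_ext fun x a => by
    rw [Module.End.mul_apply]
    by_cases h : (x.1 0).left = v
    · rw [vertexOp_single h, vertexOp_single h]
    · rw [vertexOp_single_of_ne h, map_zero]
  orth v z hvz := Finsupp.lhom_ext fun x a => by
    rw [Module.End.mul_apply]
    by_cases h : (x.1 0).left = z
    · rw [vertexOp_single h, vertexOp_single_of_ne (h ▸ hvz.symm), LinearMap.zero_apply]
    · rw [vertexOp_single_of_ne h, map_zero, LinearMap.zero_apply]
  source_edge e := Finsupp.lhom_ext fun x a => by
    rw [Module.End.mul_apply]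
    by_cases h : e.right = (x.1 0).left
    · rw [edgeOp_single θ h, vertexOp_single (v := e.left) (x := cons e x h) rfl]
    · rw [edgeOp_single_of_ne θ h, map_zero]
  edge_range e := Finsupp.lhom_ext fun x a => by
    rw [Module.End.mul_apply]
    by_cases h : e.right = (x.1 0).left
    · rw [vertexOp_single h.symm]
    · rw [vertexOp_single_of_ne (Ne.symm h), map_zero, edgeOp_single_of_ne θ h]
  range_ghost e := Finsupp.lhom_ext fun x a => by
    rw [Module.End.mul_apply]
    by_cases h : x.1 0 = e
    · rw [ghostOp_single θ h, vertexOp_single (h ▸ x.right_head.symm)]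
    · rw [ghostOp_single_of_ne θ h, map_zero]
  ghost_source e := Finsupp.lhom_ext fun x a => by
    rw [Module.End.mul_apply]
    by_cases h : (x.1 0).left = e.left
    · rw [vertexOp_single h]
    · rw [vertexOp_single_of_ne h, map_zero,
        ghostOp_single_of_ne θ fun h' => h (congrArg Quiver.Total.left h')]
  ck1_self e := Finsupp.lhom_ext fun x a => by
    rw [Module.End.mul_apply]
    by_cases h : e.right = (x.1 0).left
    · rw [edgeOp_single θ h, ghostOp_single θ (cons_zero e x h), vertexOp_single h.symm,
        tail_cons, mul_assoc, Units.mul_inv, mul_one]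
    · rw [edgeOp_single_of_ne θ h, map_zero, vertexOp_single_of_ne (Ne.symm h)]
  ck1_ne e f hef := Finsupp.lhom_ext fun x a => by
    rw [Module.End.mul_apply, LinearMap.zero_apply]
    by_cases h : f.right = (x.1 0).left
    · rw [edgeOp_single θ h, ghostOp_single_of_ne θ (Ne.symm hef)]
    · rw [edgeOp_single_of_ne θ h, map_zero]
  ck2 v hfin _ := Finsupp.lhom_ext fun x a => by
    rw [LinearMap.sum_apply]
    by_cases h : (x.1 0).left = v
    · rw [Finset.sum_eq_single (x.1 0)]
      · rw [Module.End.mul_apply, ghostOp_single θ rfl, edgeOp_single θ x.right_head, cons_tail,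
          vertexOp_single h, mul_assoc, Units.inv_mul, mul_one]
      · intro e _ he
        rw [Module.End.mul_apply, ghostOp_single_of_ne θ he.symm, map_zero]
      · intro h'
        exact absurd (hfin.mem_toFinset.2 h) h'
    · rw [vertexOp_single_of_ne h, Finset.sum_eq_zero]
      intro e he
      rw [Module.End.mul_apply, ghostOp_single_of_ne, map_zero]
      rintro rfl
      exact h (hfin.mem_toFinset.1 he)

/-- The product of the actions of the ghosts of the first `n` edges of `p`. It removes the first `n`
edges from each path that agrees with `p` there, up to weights, and sends the other paths to `0`. -/
noncomputable def iterGhostOp (p : ChenPath q) : ℕ → Module.End A (ChenPath q →₀ A)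
  | 0 => 1
  | n + 1 => ghostOp θ (p.1 n) * iterGhostOp p n

theorem iterGhostOp_single (p : ChenPath q) (n : ℕ) (a : A) :
    iterGhostOp θ p n (Finsupp.single p a) =
      Finsupp.single (tail^[n] p) (a * ↑(∏ i ∈ Finset.range n, θ (tail^[i] p))⁻¹) := by
  induction n with
  | zero => simp [iterGhostOp]
  | succ n ih =>
    rw [iterGhostOp, Module.End.mul_apply, ih, ghostOp_single θ, Function.iterate_succ_apply',
      Finset.prod_range_succ, mul_inv, Units.val_mul, mul_assoc]
    rw [iterate_tail_apply, zero_add]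

theorem iterGhostOp_congr (p x : ChenPath q) (n : ℕ) (h : ∀ i < n, x.1 i = p.1 i) :
    iterGhostOp θ p n = iterGhostOp θ x n := by
  induction n with
  | zero => rfl
  | succ n ih =>
    rw [iterGhostOp, iterGhostOp, ih fun i hi => h i (hi.trans n.lt_succ_self),
      h n n.lt_succ_self]

theorem iterGhostOp_single_of_ne (p x : ChenPath q) {n i : ℕ} (hi : i < n) (h : x.1 i ≠ p.1 i)
    (a : A) : iterGhostOp θ p n (Finsupp.single x a) = 0 := by
  classical
  have hex : ∃ i, x.1 i ≠ p.1 i := ⟨i, h⟩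
  -- The first difference kills the path; up to there `p` may be replaced by `x`.
  have hlt : Nat.find hex < n := (Nat.find_min' hex h).trans_lt hi
  have key : iterGhostOp θ p (Nat.find hex + 1) (Finsupp.single x a) = 0 := by
    rw [iterGhostOp, Module.End.mul_apply, iterGhostOp_congr θ p x _ fun i hi =>
      not_not.1 (Nat.find_min hex hi), iterGhostOp_single, ghostOp_single_of_ne]
    rw [iterate_tail_apply, zero_add]
    exact Nat.find_spec hex
  obtain ⟨d, rfl⟩ := Nat.exists_eq_add_of_le (Nat.succ_le_of_lt hlt)
  clear hlt hi
  induction d with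
  | zero => exact key
  | succ d ih => rw [← Nat.add_assoc, iterGhostOp, Module.End.mul_apply, ih, map_zero]

/-- Removing a period of `p` does not change the coefficient at `p` if all weights are `1`. -/
theorem iterGhostOp_one_apply_self {p : ChenPath q} {n : ℕ} (hn : tail^[n] p = p)
    (m : ChenPath q →₀ A) : iterGhostOp (1 : ChenPath q → Aˣ) p n m p = m p := by
  classical
  induction m using Finsupp.induction_linear with
  | zero => simp
  | add f g hf hg => rw [map_add, Finsupp.add_apply, hf, hg, Finsupp.add_apply]
  | single x a =>
    by_cases h : ∀ i < n, x.1 i = p.1 i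
    · rw [iterGhostOp_congr _ p x n h, iterGhostOp_single]
      simp only [Pi.one_apply, Finset.prod_const_one, inv_one, Units.val_one, mul_one,
        Finsupp.single_apply]
      refine if_congr ⟨fun hx => ?_, fun hx => by rw [hx, hn]⟩ rfl rfl
      exact eq_of_forall_lt_of_iterate_tail_eq h (hx.trans hn.symm)
    · push Not at h
      obtain ⟨i, hi, hne⟩ := h
      rw [iterGhostOp_single_of_ne _ p x hi hne, Finsupp.zero_apply, Finsupp.single_eq_of_ne]
      rintro rfl
      exact hne rfl

/-- A path in the support of `m` can be isolated by removing sufficiently many of its edges. -/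
theorem exists_iterGhostOp_eq_single (m : ChenPath q →₀ A) (p : ChenPath q) :
    ∃ n, iterGhostOp (1 : ChenPath q → Aˣ) p n m = Finsupp.single (tail^[n] p) (m p) := by
  classical
  -- For each `x ≠ p`, a position at which `x` and `p` differ.
  have hdiff : ∀ x : ChenPath q, ∃ i, x ≠ p → x.1 i ≠ p.1 i := by
    intro x
    by_cases hx : x = p
    · exact ⟨0, fun h => absurd hx h⟩
    · obtain ⟨i, hi⟩ := Function.ne_iff.1 fun h => hx (Subtype.ext h)
      exact ⟨i, fun _ => hi⟩
  choose d hd using hdiff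
  refine ⟨m.support.sup d + 1, ?_⟩
  trans iterGhostOp 1 p (m.support.sup d + 1) (m.sum Finsupp.single)
  · rw [m.sum_single]
  rw [Finsupp.sum, map_sum, Finset.sum_eq_single p]
  · rw [iterGhostOp_single]
    simp
  · intro x hx hxp
    exact iterGhostOp_single_of_ne _ p x (Nat.lt_succ_of_le (Finset.le_sup hx)) (hd x hxp) _
  · intro hp
    rw [Finsupp.notMem_support_iff.1 hp, Finsupp.single_zero, map_zero]

end ChenPath

end Chen

/-! ### Simple modules that are not injective -/

section ChenModule

open LeavittPathAlgebra

namespace ChenPath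

variable {V : Type*} [Quiver V] {q : ℕ → Quiver.Total V} (K : Type*) [Field K] {A : Type*}
  [CommRing A] [Algebra K A] (θ : ChenPath q → Aˣ)

/-- The representation of the Leavitt path algebra on the free `A`-module over the paths that are
tail equivalent to `q`, with weights `θ`. -/
noncomputable def rep : LeavittPathAlgebra V K →ₙₐ[K] Module.End A (ChenPath q →₀ A) :=
  (existsUnique_hom V K _ _ _ (isLeavittFamily_op θ)).choose

theorem rep_vertex (v : V) : rep K θ (gen V K (.vertex v)) = vertexOp A v :=
  (existsUnique_hom V K _ _ _ (isLeavittFamily_op θ)).choose_spec.1.1 v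

theorem rep_edge (e : Quiver.Total V) : rep K θ (gen V K (.edge e)) = edgeOp θ e :=
  (existsUnique_hom V K _ _ _ (isLeavittFamily_op θ)).choose_spec.1.2.1 e

theorem rep_ghost (e : Quiver.Total V) : rep K θ (gen V K (.ghost e)) = ghostOp θ e :=
  (existsUnique_hom V K _ _ _ (isLeavittFamily_op θ)).choose_spec.1.2.2 e

/-- The module of the representation `ChenPath.rep`. For weights `1` over `A = K` this is the Chen
module of the infinite path `q`. -/
noncomputable abbrev module : NonUnitalModule (LeavittPathAlgebra V K) (ChenPath q →₀ A) where
  smul r m := rep K θ r m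
  smul_add r x y := map_add (rep K θ r) x y
  add_smul r s x := by
    change rep K θ (r + s) x = rep K θ r x + rep K θ s x
    rw [map_add, LinearMap.add_apply]
  mul_smul r s x := by
    change rep K θ (r * s) x = rep K θ r (rep K θ s x)
    rw [map_mul, Module.End.mul_apply]

theorem isUnitary :
    @NonUnitalModule.IsUnitary (LeavittPathAlgebra V K) (ChenPath q →₀ A) _ _ (module K θ) := by
  let := module K θ
  refine (AddSubgroup.eq_top_iff' _).2 fun m => ?_
  induction m using Finsupp.induction_linear with
  | zero => exact zero_mem _
  | add f g hf hg => exact add_mem hf hg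
  | single x a =>
    refine AddSubgroup.subset_closure ⟨gen V K (.vertex (x.1 0).left), Finsupp.single x a, ?_⟩
    change _ = rep K θ _ _
    rw [rep_vertex, vertexOp_single rfl]

theorem isSimple (hq : IsInfinitePath q) :
    @NonUnitalModule.IsSimple (LeavittPathAlgebra V K) (ChenPath q →₀ K) _ _
      (module K (1 : ChenPath q → Kˣ)) := by
  let := module K (1 : ChenPath q → Kˣ)
  refine ⟨⟨gen V K (.vertex (q 0).left), Finsupp.single ⟨q, hq, 0, 0, fun _ => rfl⟩ 1, ?_⟩,
    fun N hN => or_iff_not_imp_left.2 fun hbot => ?_⟩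
  · change rep K _ _ _ ≠ 0
    rw [rep_vertex, vertexOp_single (x := ⟨q, hq, 0, 0, fun _ => rfl⟩) rfl]
    simp
  have hghost : ∀ e, ∀ m ∈ N, ghostOp 1 e m ∈ N := fun e m hm => by
    rw [← rep_ghost K]
    exact hN _ m hm
  have hiter : ∀ p n, ∀ m ∈ N, iterGhostOp 1 p n m ∈ N := by
    intro p n m hm
    induction n with
    | zero => exact hm
    | succ n ih => exact hghost _ _ ih
  -- Membership of a path in `N` depends only on its tail class.
  have htail : ∀ (x : ChenPath q) (a : K),
      Finsupp.single x.tail a ∈ N ↔ Finsupp.single x a ∈ N := by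
    intro x a
    constructor <;> intro hx
    · have := hN (gen V K (.edge (x.1 0))) _ hx
      change rep K _ _ _ ∈ N at this
      rw [rep_edge, edgeOp_single _ x.right_head] at this
      simpa using this
    · have := hghost (x.1 0) _ hx
      rw [ghostOp_single _ rfl] at this
      simpa using this
  have htails : ∀ (n : ℕ) (x : ChenPath q) (a : K),
      Finsupp.single (tail^[n] x) a ∈ N ↔ Finsupp.single x a ∈ N := by
    intro n
    induction n with
    | zero => exact fun _ _ => Iff.rfl
    | succ n ih =>
      intro x a
      rw [Function.iterate_succ_apply, ih, htail]
  obtain ⟨m, hm, hm0⟩ := (AddSubgroup.bot_or_exists_ne_zero N).resolve_left hbot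
  obtain ⟨p, hp⟩ := Finsupp.ne_iff.1 hm0
  have hsingle : Finsupp.single p (m p) ∈ N := by
    obtain ⟨n, hn⟩ := exists_iterGhostOp_eq_single m p
    rw [← htails n, ← hn]
    exact hiter p n m hm
  have hscalar : ∀ b, Finsupp.single p b ∈ N := by
    intro b
    have := hN ((b / m p) • gen V K (.vertex (p.1 0).left)) _ hsingle
    change rep K _ _ _ ∈ N at this
    rw [map_smul, rep_vertex, LinearMap.smul_apply, vertexOp_single rfl, Finsupp.smul_single,
      smul_eq_mul, div_mul_cancel₀ _ hp] at this
    exact this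
  refine (AddSubgroup.eq_top_iff' _).2 fun m => ?_
  induction m using Finsupp.induction_linear with
  | zero => exact zero_mem _
  | add f g hf hg => exact add_mem hf hg
  | single x a =>
    obtain ⟨i, j, hij⟩ := exists_iterate_tail_eq x p
    rw [← htails i, hij, htails j]
    exact hscalar a

/-- The weights `1 + ε` at the path `p`, and `1` elsewhere. -/
noncomputable def dualWeight (p : ChenPath q) : ChenPath q → (DualNumber K)ˣ :=
  open scoped Classical in
  Function.update 1 p
    ⟨1 + DualNumber.eps, 1 - DualNumber.eps, by ring_nf; simp [sq], by ring_nf; simp [sq]⟩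

theorem inr_mul_dualWeight (p x : ChenPath q) (a : K) :
    TrivSqZeroExt.inr a * (dualWeight K p x : DualNumber K) = TrivSqZeroExt.inr a := by
  classical
  rw [dualWeight, Function.update_apply]
  split_ifs
  · ext <;> simp
  · simp

theorem inr_mul_inv_dualWeight (p x : ChenPath q) (a : K) :
    TrivSqZeroExt.inr a * (↑(dualWeight K p x)⁻¹ : DualNumber K) = TrivSqZeroExt.inr a := by
  rw [Units.mul_inv_eq_iff_eq_mul, inr_mul_dualWeight]

/-- The inclusion of the Chen module as the multiples of `ε` in the weighted module. -/
noncomputable def inrMap (q : ℕ → Quiver.Total V) :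
    (ChenPath q →₀ K) →+ (ChenPath q →₀ DualNumber K) :=
  Finsupp.mapRange.addMonoidHom (TrivSqZeroExt.inrHom K K).toAddMonoidHom

theorem inrMap_single (x : ChenPath q) (a : K) :
    inrMap K q (Finsupp.single x a) = Finsupp.single x (TrivSqZeroExt.inr a) := by
  simp [inrMap]

theorem inrMap_injective : Function.Injective (inrMap K q) :=
  Finsupp.mapRange_injective _ rfl TrivSqZeroExt.inr_injective

theorem inrMap_rep (p : ChenPath q) (r : LeavittPathAlgebra V K) (m : ChenPath q →₀ K) :
    inrMap K q (rep K 1 r m) = rep K (dualWeight K p) r (inrMap K q m) := by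
  induction r using LeavittPathAlgebra.induction generalizing m with
  | gen g =>
    induction m using Finsupp.induction_linear with
    | zero => simp
    | add f g hf hg => simp only [map_add, hf, hg]
    | single x a =>
      rw [inrMap_single]
      cases g with
      | vertex v =>
        rw [rep_vertex, rep_vertex]
        by_cases h : (x.1 0).left = v
        · rw [vertexOp_single h, vertexOp_single h, inrMap_single]
        · rw [vertexOp_single_of_ne h, vertexOp_single_of_ne h, map_zero]
      | edge e =>
        rw [rep_edge, rep_edge]
        by_cases h : e.right = (x.1 0).left
        · rw [edgeOp_single _ h, edgeOp_single _ h, inrMap_single, inr_mul_dualWeight]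
          simp
        · rw [edgeOp_single_of_ne _ h, edgeOp_single_of_ne _ h, map_zero]
      | ghost e =>
        rw [rep_ghost, rep_ghost]
        by_cases h : x.1 0 = e
        · rw [ghostOp_single _ h, ghostOp_single _ h, inrMap_single, inr_mul_inv_dualWeight]
          simp
        · rw [ghostOp_single_of_ne _ h, ghostOp_single_of_ne _ h, map_zero]
  | zero => simp
  | add r s hr hs => simp only [map_add, LinearMap.add_apply, hr, hs]
  | mul r s hr hs => simp only [map_mul, Module.End.mul_apply, hr, hs]
  | smul k r hr =>
    have hk : ∀ m : ChenPath q →₀ K, inrMap K q (k • m) = k • inrMap K q m := by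
      intro m
      ext x <;> simp [inrMap]
    simp only [map_smul, LinearMap.smul_apply, hk, hr]

/-- The Chen module of a periodic infinite path is not injective: it is not a direct summand of
the module over the dual numbers in which going round the period multiplies the path by `1 + ε`. -/
theorem not_isInjective {p : ChenPath q} {n : ℕ} (hn : 0 < n) (hp : tail^[n] p = p) :
    ¬ @NonUnitalModule.IsInjective (LeavittPathAlgebra V K) (ChenPath q →₀ K) _ _
      (module K (1 : ChenPath q → Kˣ)) := by
  classical
  let := module K (1 : ChenPath q → Kˣ)
  let := module K (dualWeight K p)
  rintro ⟨-, hinj⟩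
  obtain ⟨h, hsmul, hinr⟩ := hinj _ (ChenPath q →₀ DualNumber K) (isUnitary K 1)
    (isUnitary K (dualWeight K p)) (inrMap K q) (AddMonoidHom.id _)
    (fun r m => inrMap_rep K p r m) (inrMap_injective K) (fun _ _ => rfl)
  -- For the minimal period, exactly one weight met along the period differs from `1`.
  set d := Function.minimalPeriod tail p with hd
  have hd0 : 0 < d := Function.minimalPeriod_pos_of_mem_periodicPts ⟨n, hn, hp⟩
  have hdp : tail^[d] p = p := Function.iterate_minimalPeriod
  have hghost : ∀ e m, h (ghostOp (dualWeight K p) e m) = ghostOp 1 e (h m) := by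
    intro e m
    rw [← rep_ghost K, ← rep_ghost K]
    exact hsmul _ _
  have hiter : ∀ k m, h (iterGhostOp (dualWeight K p) p k m) = iterGhostOp 1 p k (h m) := by
    intro k m
    induction k with
    | zero => rfl
    | succ k ih =>
      rw [iterGhostOp, iterGhostOp, Module.End.mul_apply, Module.End.mul_apply, hghost, ih]
  have hprod : ∏ i ∈ Finset.range d, dualWeight K p (tail^[i] p) = dualWeight K p p := by
    rw [Finset.prod_eq_single 0]
    · rfl
    · intro i hi hi0
      have : tail^[i] p ≠ p := fun hip =>
        Function.not_isPeriodicPt_of_pos_of_lt_minimalPeriod hi0 (Finset.mem_range.1 hi) hip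
      rw [dualWeight, Function.update_of_ne this, Pi.one_apply]
    · intro h0
      exact absurd (Finset.mem_range.2 hd0) h0
  have hinv : (↑(dualWeight K p p)⁻¹ : DualNumber K) = 1 - TrivSqZeroExt.inr 1 := by
    rw [dualWeight, Function.update_self]
    rfl
  have key := congrArg (fun m => m p) (hiter d (Finsupp.single p 1))
  simp only [iterGhostOp_one_apply_self hdp] at key
  rw [iterGhostOp_single, hdp, hprod, hinv, one_mul, Finsupp.single_sub, map_sub, ← inrMap_single,
    hinr] at key
  simp at key

end ChenPath

end ChenModule

theorem mainTheorem1 (V : Type u) [Quiver.{v} V] (K : Type w) [Field K]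
    (h : ∀ (S : Type (max u v w)) [AddCommGroup S] [NonUnitalModule (LeavittPathAlgebra V K) S],
      NonUnitalModule.IsSimple (LeavittPathAlgebra V K) S →
        NonUnitalModule.IsInjective (LeavittPathAlgebra V K) S) :
    IsVonNeumannRegular (LeavittPathAlgebra V K) := by
  refine LeavittPathAlgebra.isVonNeumannRegular_of_forall_not_periodic fun q hq n hn hper => ?_
  let p : ChenPath q := ⟨q, hq, 0, 0, fun _ => rfl⟩
  refine ChenPath.not_isInjective K (p := p) hn (Subtype.ext (funext fun i => ?_))
    (@h _ _ (ChenPath.module K 1) (ChenPath.isSimple K hq))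
  rw [ChenPath.iterate_tail_apply]
  exact hper i
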